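/- Let $\Sigma_1=\{a,\bar a\}$, and let the effect $\Delta(w)\in\mathbb Z$ of a word $w\in\Sigma_1^*$ be its number of letters $a$ minus its number of letters $\bar a$. Let $D_1\subseteq\Sigma_1^*$ be the one-counter Dyck language: the words $w$ with $\Delta(w)=0$ all of whose prefixes $u$ satisfy $\Delta(u)\ge 0$. A linear set is a set $L=b+P^*\subseteq\mathbb Z$ with $b\in\mathbb Z$ and $P\subseteq\mathbb Z$ finite, where $P^*$ is the additive monoid generated by $P$. For $k\in\mathbb N$, the $k$-th regular approximation $L{\restriction}_k\subseteq\Sigma_1^*$ of $L=b+P^*$ is the language of the finite automaton with state set $[-k,k]\cap\mathbb Z$, initial state $0$, final states $L\cap[-k,k]$, transitions $x\xrightarrow{a}x+1$ and $x\xrightarrow{\bar a}x-1$, and $\varepsilon$-transitions $x\xrightarrow{\varepsilon}x-p$ for $p\in P$ (only transitions that stay inside $[-k,k]$ are present). For $K,L\subseteq\mathbb Z$ let $K\odot L=\{x+y : x\in K\cap\mathbb N,\ y\in L\}\cap\mathbb N$. Define $$\mathcal R_2=\{\,L_1{\restriction}_k\cdot L_2{\restriction}_k \;:\; k\in\mathbb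 N,\ L_1,L_2 \text{ linear sets},\ 0\notin L_1\odot L_2\,\}.$$ A set $\mathcal B$ of languages finitely covers a language $L$ if $L\subseteq\bigcup_{K\in\mathcal C}K$ for some finite $\mathcal C\subseteq\mathcal B$. A set $\mathcal B$ of regular languages is a $D_1$-basic-separator set if every $K\in\mathcal B$ is disjoint from $D_1$, and $\mathcal B$ finitely covers every regular language $L\subseteq\Sigma_1^*$ with $L\cap D_1=\emptyset$. **Lemma.** The set $\mathcal R_2$ is a $D_1$-basic-separator set. Moreover, $\mathcal R_2$ finitely covers each of the following languages, which are the basic separators of Czerwiński and Zetzsche for $D_1$: * $\{w : \Delta(w)\equiv v \pmod \mu\}$ for $\mu\ge 1$ and $v\not\equiv 0\pmod\mu$; * $\{wy : \Delta(w)<0 \text{ and } 0\le\Delta(u)\le k \text{ for all proper prefixes } u \text{ of } w\}$ for $k\in\mathbb N$; * $\{yw : \Delta(w)>0 \text{ and } 0\le-\Delta(u)\le k \text{ for all proper suffixes } u \text{ of } w\}$ for $k\in\mathbb N$. Both assertions hold if in the definition of $\mathcal R_2$ all presentations $(b,P)$ of linear sets are allowed, and also if each linear set is only taken with its period set $P$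 that is minimal in an arbitrary fixed well-order on the finite subsets of $\mathbb Z$. -/

import Mathlib

namespace DyckSep

/-- The alphabet `Σ_n`: an increment letter and a decrement letter for each counter. -/
inductive Letter (n : ℕ) : Type where
  | inc (i : Fin n) : Letter n
  | dec (i : Fin n) : Letter n

/-- The counter update of a letter: plus or minus a unit vector. -/
def letterEffect {n : ℕ} : Letter n → (Fin n → ℤ)
  | Letter.inc i => Pi.single i 1
  | Letter.dec i => -Pi.single i 1

/-- The effect of a word: the sum of the updates of its letters. -/
def effect {n : ℕ} (w : List (Letter n)) : Fin n → ℤ :=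
  (w.map letterEffect).sum

/-- The Dyck language `D_n`: words that lead all counters from zero to zero, where after each
prefix all counters are non-negative. -/
def dyck (n : ℕ) : Language (Letter n) :=
  {w | (∀ u, u <+: w → 0 ≤ effect u) ∧ effect w = 0}

/-- `L` is contained in a finite union of members of `B`. -/
def FinitelyCovers {α : Type} (B : Set (Language α)) (L : Language α) : Prop :=
  ∃ C : Set (Language α), C ⊆ B ∧ C.Finite ∧ ∀ w ∈ L, ∃ K ∈ C, w ∈ K

/-- `B` is an `S`-basic-separator set: a set of regular languages disjoint from `S` that finitely
covers each regular language disjoint from `S`. -/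
def IsBasicSeparatorSet {α : Type} (S : Language α) (B : Set (Language α)) : Prop :=
  (∀ K ∈ B, K.IsRegular) ∧
  (∀ K ∈ B, ∀ w ∈ K, w ∉ S) ∧
  ∀ L : Language α, L.IsRegular → (∀ w ∈ L, w ∉ S) → FinitelyCovers B L

/-- A linear set `b + P^*` of integer vectors, with its base vector and finite set of periods. -/
structure LinearSet (n : ℕ) where
  base : Fin n → ℤ
  periods : Finset (Fin n → ℤ)

/-- The vectors in a linear set; `P^*` is the additive submonoid generated by `P`. -/
def LinearSet.carrier {n : ℕ} (L : LinearSet n) : Set (Fin n → ℤ) :=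
  {x | ∃ y ∈ AddSubmonoid.closure (L.periods : Set (Fin n → ℤ)), x = L.base + y}

/-- The presentations whose period set is minimal, with respect to `r`, among all finite period
sets that present the same set of vectors. -/
def minimalPresentations {n : ℕ}
    (r : Finset (Fin n → ℤ) → Finset (Fin n → ℤ) → Prop) : Set (LinearSet n) :=
  {L | ∀ L' : LinearSet n, L'.carrier = L.carrier → ¬ r L'.periods L.periods}

/-- The box `[-k, k]^n`. -/
abbrev Box (n k : ℕ) : Type := {v : Fin n → ℤ // ∀ i, -(k : ℤ) ≤ v i ∧ v i ≤ k}

/-- The automaton with states `[-k, k]^n` and initial state `0` that adds the effect of each letter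
it reads, may subtract a period without reading a letter, and accepts in the states in `L`. -/
def approxNFA {n : ℕ} (k : ℕ) (L : LinearSet n) : εNFA (Letter n) (Box n k) where
  step := fun v a => match a with
    | some a => {v' | v'.1 = v.1 + letterEffect a}
    | none => {v' | ∃ p ∈ L.periods, v'.1 = v.1 - p}
  start := {v | v.1 = 0}
  accept := {v | v.1 ∈ L.carrier}

/-- The `k`-th regular approximation of the linear set `L`. -/
def approx {n : ℕ} (k : ℕ) (L : LinearSet n) : Language (Letter n) :=
  (approxNFA k L).accepts

/-- `K ⊙ L = {k + l | k ∈ K ∩ ℕ^n, l ∈ L} ∩ ℕ^n`. -/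
def posApply {n : ℕ} (K L : Set (Fin n → ℤ)) : Set (Fin n → ℤ) :=
  {x | 0 ≤ x ∧ ∃ k ∈ K, 0 ≤ k ∧ ∃ l ∈ L, x = k + l}

/-- `L₁ ⊙ L₂ ⊙ ⋯ ⊙ L_ℓ`, bracketed to the left; it is `L₁` for `ℓ = 1`, and `{0}` for `ℓ = 0`. -/
def posApplyList {n : ℕ} : List (Set (Fin n → ℤ)) → Set (Fin n → ℤ)
  | [] => {0}
  | L :: Ls => Ls.foldl posApply L

/-- The set `R_ℓ` of the concatenations of the `k`-th approximations of `ℓ` linear sets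
`L₁, …, L_ℓ`, for some `k`, with `0 ∉ L₁ ⊙ ⋯ ⊙ L_ℓ`. The linear sets are taken with presentations
from `X`. -/
def approxConcat {n : ℕ} (X : Set (LinearSet n)) (ℓ : ℕ) : Set (Language (Letter n)) :=
  {K | ∃ (k : ℕ) (Ls : List (LinearSet n)), Ls.length = ℓ ∧ (∀ L ∈ Ls, L ∈ X) ∧
    0 ∉ posApplyList (Ls.map LinearSet.carrier) ∧ K = (Ls.map (approx k)).prod}

/-- Words with effect `v` modulo `μ`. -/
def modLang {n : ℕ} (μ : ℕ) (v : Fin n → ℤ) : Language (Letter n) :=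
  {w | ∀ i, effect w i ≡ v i [ZMOD μ]}

/-- Words on which counter `i` falls below `0` before it exceeds `k`. -/
def covSep {n : ℕ} (k : ℕ) (i : Fin n) : Language (Letter n) :=
  {x | ∃ w y : List (Letter n), x = w ++ y ∧ effect w i < 0 ∧
    ∀ u, u <+: w → u ≠ w → 0 ≤ effect u i ∧ effect u i ≤ k}

/-- The image of `covSep k i` under reversing words and exchanging increments and decrements. -/
def revCovSep {n : ℕ} (k : ℕ) (i : Fin n) : Language (Letter n) :=
  {x | ∃ y w : List (Letter n), x = y ++ w ∧ -effect w i < 0 ∧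
    ∀ u, u <:+ w → u ≠ w → 0 ≤ -effect u i ∧ -effect u i ≤ k}

/-- The basic separators of Czerwiński and Zetzsche for one counter. -/
def oneCounterSeps : Set (Language (Letter 1)) :=
  {K | ∃ (μ : ℕ) (v : Fin 1 → ℤ), 1 ≤ μ ∧ (∃ i, ¬ v i ≡ 0 [ZMOD μ]) ∧ K = modLang μ v} ∪
  {K | ∃ k : ℕ, K = covSep k 0} ∪
  {K | ∃ k : ℕ, K = revCovSep k 0}

end DyckSep

namespace DyckSep

/-! ### Regularity -/

/-! Disjointness: a run of an approximation keeps the effect read so far equal to the current state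
plus an element of `P^*`, so an accepted word has its effect in the linear set. If `u ++ v` is a
Dyck word, then `u` has nonnegative effect and the two effects sum to 0, which puts 0 into `L₁ ⊙
L₂`.

Covering: let a DFA recognise a language disjoint from the Dyck language, and let `N` be the number
of self-maps of its state set. Each accepted word lies in `covSep N 0`, lies in `revCovSep N 0`, or
has effect not divisible by `N!` (`exists_basicSeparator_mem`). Otherwise it has a prefix climbing
from 0 to `N + 1` and a disjoint suffix that does so in mirror image; pigeonhole finds a rising and
a falling cycle whose heights divide `N!`, and pumping both yields an accepted Dyck word.

It remains to put each basic separator into one member of `R_2`: the pairs are (residue class,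
`{0}`), (`{-1}`, `ℤ`) and (`ℤ`, `{1}`). Approximations of a residue class contain all words of the
class once `k` is large, whatever the presentation, so it suffices that every linear set has some
admissible presentation. -/

theorem isRegular_mul {α : Type} {L₁ L₂ : Language α} (h₁ : L₁.IsRegular) (h₂ : L₂.IsRegular) :
    (L₁ * L₂).IsRegular := by
  refine Language.IsRegular.of_finite_range_leftQuotient ?_
  have f₁ := h₁.finite_range_leftQuotient
  have f₂ := h₂.finite_range_leftQuotient
  -- The quotient of `L₁ * L₂` by `w` is determined by the quotient of `L₁` by `w` and the set of
  -- quotients of `L₂` by those `v` with `w = u ++ v`, `u ∈ L₁`. Only finitely many such pairs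
  -- exist.
  refine ((f₁.prod f₂.finite_subsets).image
    (fun A : Language α × Set (Language α) =>
      ({y | y ∈ A.1 * L₂ ∨ ∃ Q ∈ A.2, y ∈ Q} : Language α))).subset ?_
  rintro _ ⟨w, rfl⟩
  refine ⟨(L₁.leftQuotient w, {Q | ∃ u v, u ++ v = w ∧ u ∈ L₁ ∧ Q = L₂.leftQuotient v}),
    ⟨⟨w, rfl⟩, ?_⟩, ?_⟩
  · rintro _ ⟨u, v, -, -, rfl⟩
    exact ⟨v, rfl⟩
  · ext y
    change (y ∈ L₁.leftQuotient w * L₂ ∨ ∃ Q ∈ {Q | ∃ u v, u ++ v = w ∧ u ∈ L₁ ∧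
      Q = L₂.leftQuotient v}, y ∈ Q) ↔ w ++ y ∈ L₁ * L₂
    simp only [Language.mem_mul, Set.mem_ofPred_eq, Language.mem_leftQuotient]
    constructor
    · rintro (⟨a, ha, b, hb, rfl⟩ | ⟨_, ⟨u, v, rfl, hu, rfl⟩, hy⟩)
      · exact ⟨w ++ a, ha, b, hb, by simp⟩
      · exact ⟨u, hu, v ++ y, hy, by simp⟩
    · rintro ⟨a, ha, b, hb, hab⟩
      rcases List.append_eq_append_iff.1 hab with ⟨c, rfl, rfl⟩ | ⟨c, rfl, rfl⟩
      · exact Or.inr ⟨_, ⟨a, c, rfl, ha, rfl⟩, hb⟩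
      · exact Or.inl ⟨c, ha, b, hb, rfl⟩

instance {n k : ℕ} : Finite (Box n k) := by
  have h : (Set.Icc (fun _ => -(k : ℤ)) (fun _ => (k : ℤ)) : Set (Fin n → ℤ)).Finite :=
    Set.finite_Icc _ _
  exact (h.subset (t := {v : Fin n → ℤ | ∀ i, -(k : ℤ) ≤ v i ∧ v i ≤ k})
    fun v hv => ⟨fun i => (hv i).1, fun i => (hv i).2⟩).to_subtype

theorem approx_isRegular {n : ℕ} (k : ℕ) (L : LinearSet n) : (approx k L).IsRegular := by
  have := Fintype.ofFinite (Set (Box n k))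
  refine ⟨Set (Box n k), this, (approxNFA k L).toNFA.toDFA, ?_⟩
  rw [NFA.toDFA_correct, εNFA.toNFA_correct]
  rfl

/-! ### Regular approximations -/

theorem effect_nil {n : ℕ} : effect ([] : List (Letter n)) = 0 := rfl

theorem effect_append {n : ℕ} (u v : List (Letter n)) : effect (u ++ v) = effect u + effect v := by
  simp [effect]

theorem effect_singleton {n : ℕ} (a : Letter n) : effect [a] = letterEffect a := by
  simp [effect]

theorem exists_effect_eq_of_mem_εClosure {n k : ℕ} {L : LinearSet n} {S : Set (Box n k)}
    {e : Fin n → ℤ}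
    (h : ∀ x ∈ S, ∃ y ∈ AddSubmonoid.closure (L.periods : Set (Fin n → ℤ)), e = x.1 + y)
    (x : Box n k) (hx : x ∈ (approxNFA k L).εClosure S) :
    ∃ y ∈ AddSubmonoid.closure (L.periods : Set (Fin n → ℤ)), e = x.1 + y := by
  induction hx with
  | base s hs => exact h s hs
  | step s t ht _ ih =>
    obtain ⟨y, hy, rfl⟩ := ih
    obtain ⟨p, hp, hpt⟩ := ht
    exact ⟨p + y, add_mem (AddSubmonoid.subset_closure hp) hy, by rw [hpt]; abel⟩

theorem exists_effect_eq_of_mem_eval {n k : ℕ} {L : LinearSet n} (w : List (Letter n))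
    (x : Box n k) (hx : x ∈ (approxNFA k L).eval w) :
    ∃ y ∈ AddSubmonoid.closure (L.periods : Set (Fin n → ℤ)), effect w = x.1 + y := by
  induction w using List.reverseRecOn generalizing x with
  | nil =>
    refine exists_effect_eq_of_mem_εClosure (fun z hz => ⟨0, zero_mem _, ?_⟩) x hx
    have : z.1 = 0 := hz
    simp [effect_nil, this]
  | append_singleton w a ih =>
    rw [εNFA.eval_append_singleton, εNFA.mem_stepSet_iff] at hx
    obtain ⟨t, ht, hx⟩ := hx
    refine exists_effect_eq_of_mem_εClosure (fun z hz => ?_) x hx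
    obtain ⟨y, hy, h⟩ := ih t ht
    have hz : z.1 = t.1 + letterEffect a := hz
    exact ⟨y, hy, by rw [effect_append, h, effect_singleton, hz]; abel⟩

theorem effect_mem_carrier_of_mem_approx {n k : ℕ} {L : LinearSet n} {w : List (Letter n)}
    (hw : w ∈ approx k L) : effect w ∈ L.carrier := by
  obtain ⟨x, ⟨z, hz, hxz⟩, hx⟩ := hw
  obtain ⟨y, hy, h⟩ := exists_effect_eq_of_mem_eval w x hx
  exact ⟨z + y, add_mem hz hy, by rw [h, hxz, add_assoc]⟩

/-- The run without ε-transitions already stays in the box. -/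
theorem mem_eval_of_bounded {n k : ℕ} (L : LinearSet n) (w : List (Letter n))
    (h : ∀ u, u <+: w → ∀ i, -(k : ℤ) ≤ effect u i ∧ effect u i ≤ k) :
    (⟨effect w, h w (List.prefix_refl w)⟩ : Box n k) ∈ (approxNFA k L).eval w := by
  induction w using List.reverseRecOn with
  | nil => exact εNFA.subset_εClosure _ _ rfl
  | append_singleton w a ih =>
    rw [εNFA.eval_append_singleton, εNFA.mem_stepSet_iff]
    refine ⟨_, ih fun u hu => h u (hu.trans (List.prefix_append _ _)), ?_⟩
    refine εNFA.subset_εClosure _ _ ?_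
    change effect (w ++ [a]) = effect w + letterEffect a
    rw [effect_append, effect_singleton]

theorem mem_approx_of_bounded {n k : ℕ} (L : LinearSet n) (w : List (Letter n))
    (h : ∀ u, u <+: w → ∀ i, -(k : ℤ) ≤ effect u i ∧ effect u i ≤ k)
    (hw : effect w ∈ L.carrier) : w ∈ approx k L :=
  ⟨_, hw, mem_eval_of_bounded L w h⟩

theorem mul_disjoint_dyck {n k : ℕ} {L₁ L₂ : LinearSet n}
    (h : 0 ∉ posApply L₁.carrier L₂.carrier) :
    ∀ w ∈ approx k L₁ * approx k L₂, w ∉ dyck n := by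
  rintro _ ⟨u, hu, v, hv, rfl⟩ ⟨hpos, hzero⟩
  refine h ⟨le_rfl, effect u, effect_mem_carrier_of_mem_approx hu, hpos u (List.prefix_append _ _),
    effect v, effect_mem_carrier_of_mem_approx hv, ?_⟩
  rw [← effect_append]
  exact hzero.symm

theorem mem_approxConcat_two {n : ℕ} {X : Set (LinearSet n)} {K : Language (Letter n)} :
    K ∈ approxConcat X 2 ↔ ∃ (k : ℕ) (L₁ L₂ : LinearSet n), L₁ ∈ X ∧ L₂ ∈ X ∧
      0 ∉ posApply L₁.carrier L₂.carrier ∧ K = approx k L₁ * approx k L₂ := by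
  constructor
  · rintro ⟨k, Ls, hlen, hX, h0, rfl⟩
    obtain ⟨L₁, L₂, rfl⟩ := List.length_eq_two.1 hlen
    exact ⟨k, L₁, L₂, hX _ (by simp), hX _ (by simp), h0, by simp⟩
  · rintro ⟨k, L₁, L₂, h₁, h₂, h0, rfl⟩
    exact ⟨k, [L₁, L₂], rfl, by simp [h₁, h₂], h0, by simp⟩

/-! ### Words over one counter -/

/-- The effect of a word over one counter, as an integer. -/
def height (w : List (Letter 1)) : ℤ := effect w 0

theorem height_nil : height [] = 0 := rfl

theorem height_append (u v : List (Letter 1)) : height (u ++ v) = height u + height v := by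
  simp [height, effect_append]

theorem height_singleton (a : Letter 1) : height [a] = 1 ∨ height [a] = -1 := by
  cases a with
  | inc i => left; simp [height, effect_singleton, letterEffect, Subsingleton.elim i 0]
  | dec i => right; simp [height, effect_singleton, letterEffect, Subsingleton.elim i 0]

theorem neg_length_le_height (w : List (Letter 1)) : -(w.length : ℤ) ≤ height w := by
  induction w using List.reverseRecOn with
  | nil => simp [height_nil]
  | append_singleton w a ih =>
    rw [height_append, List.length_append, List.length_singleton]
    rcases height_singleton a with h | h <;> push_cast <;> omega

/-- Exchange of increments and decrements. -/
def Letter.flip {n : ℕ} : Letter n → Letter n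
  | .inc i => .dec i
  | .dec i => .inc i

/-- Reversal of a word together with the exchange of increments and decrements. -/
def mirror {n : ℕ} (w : List (Letter n)) : List (Letter n) := (w.map Letter.flip).reverse

theorem mirror_append {n : ℕ} (u v : List (Letter n)) : mirror (u ++ v) = mirror v ++ mirror u := by
  simp [mirror]

theorem mirror_mirror {n : ℕ} (w : List (Letter n)) : mirror (mirror w) = w := by
  have h : Letter.flip ∘ Letter.flip = (id : Letter n → Letter n) := by
    funext a
    cases a <;> rfl
  simp [mirror, h]

theorem height_mirror (w : List (Letter 1)) : height (mirror w) = -height w := by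
  induction w with
  | nil => rfl
  | cons a w ih =>
    rw [← List.singleton_append, mirror_append, height_append, height_append, ih]
    have : height (mirror [a]) = -height [a] := by
      cases a <;> simp [mirror, Letter.flip, height, effect_singleton, letterEffect]
    omega

theorem mirror_prefix_mirror {n : ℕ} {u v : List (Letter n)} (h : u <:+ v) :
    mirror u <+: mirror v := by
  obtain ⟨t, rfl⟩ := h
  exact ⟨mirror t, (mirror_append _ _).symm⟩

theorem mirror_suffix_mirror {n : ℕ} {u v : List (Letter n)} (h : u <+: v) :
    mirror u <:+ mirror v := by
  obtain ⟨t, rfl⟩ := h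
  exact ⟨mirror t, (mirror_append _ _).symm⟩

/-- Reading `w` from counter value `c`, the counter never becomes negative. -/
def NonnegFrom (c : ℤ) (w : List (Letter 1)) : Prop := ∀ u, u <+: w → 0 ≤ c + height u

theorem NonnegFrom.mono {c d : ℤ} {w : List (Letter 1)} (h : NonnegFrom c w) (hcd : c ≤ d) :
    NonnegFrom d w := fun u hu => by linarith [h u hu]

theorem nonnegFrom_append {c : ℤ} {u v : List (Letter 1)} :
    NonnegFrom c (u ++ v) ↔ NonnegFrom c u ∧ NonnegFrom (c + height u) v := by
  constructor
  · refine fun h => ⟨fun t ht => h t (ht.trans (List.prefix_append _ _)), fun t ht => ?_⟩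
    have := h (u ++ t) ((List.prefix_append_right_inj u).2 ht)
    rwa [height_append, ← add_assoc] at this
  · rintro ⟨hu, hv⟩ t ht
    obtain ⟨r, hr⟩ := ht
    rcases List.append_eq_append_iff.1 hr with ⟨s, rfl, -⟩ | ⟨s, rfl, rfl⟩
    · exact hu t (List.prefix_append _ _)
    · have := hv s (List.prefix_append _ _)
      rwa [height_append, ← add_assoc]

theorem nonnegFrom_length (w : List (Letter 1)) : NonnegFrom w.length w := fun u hu => by
  have := neg_length_le_height u
  have := hu.length_le
  omega

theorem mem_dyck_one_iff {w : List (Letter 1)} : w ∈ dyck 1 ↔ NonnegFrom 0 w ∧ height w = 0 := by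
  constructor
  · rintro ⟨h, h0⟩
    exact ⟨fun u hu => by simpa [height] using h u hu 0, congrFun h0 0⟩
  · rintro ⟨h, h0⟩
    refine ⟨fun u hu i => ?_, funext fun i => ?_⟩
    · rw [Subsingleton.elim i 0]
      simpa [height] using h u hu
    · rw [Subsingleton.elim i 0]
      exact h0

/-- The condition on `mirror v` says that suffixes of `v` have effect at most 0. As the total is 0,
the counter before each such suffix is nonnegative. -/
theorem append_mem_dyck {u v : List (Letter 1)} (hu : NonnegFrom 0 u)
    (hv : NonnegFrom 0 (mirror v)) (h : height u + height v = 0) : u ++ v ∈ dyck 1 := by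
  rw [mem_dyck_one_iff, nonnegFrom_append, height_append]
  refine ⟨⟨hu, ?_⟩, h⟩
  rintro s ⟨t, rfl⟩
  have := hv (mirror t) (by rw [mirror_append]; exact List.prefix_append _ _)
  rw [height_mirror] at this
  rw [height_append] at h
  omega

/-! ### Pumping -/

theorem exists_prefix_height_eq {n : ℕ} (w : List (Letter 1)) (h : (n : ℤ) ≤ height w) :
    ∃ u, u <+: w ∧ height u = n := by
  induction w using List.reverseRecOn with
  | nil => exact ⟨[], List.prefix_rfl, by rw [height_nil] at h ⊢; omega⟩
  | append_singleton w a ih =>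
    by_cases hw : (n : ℤ) ≤ height w
    · obtain ⟨u, hu, hn⟩ := ih hw
      exact ⟨u, hu.trans (List.prefix_append _ _), hn⟩
    · refine ⟨_, List.prefix_rfl, ?_⟩
      rw [height_append] at h ⊢
      rcases height_singleton a with h' | h' <;> omega

/-- Nested prefixes, one per height, make any pigeonhole collision a factor of strictly positive
effect. -/
theorem exists_prefix_chain {n : ℕ} (w : List (Letter 1)) (h : (n : ℤ) ≤ height w) :
    ∃ g : ℕ → List (Letter 1), (∀ i ≤ n, height (g i) = i) ∧
      (∀ i j, i ≤ j → j ≤ n → g i <+: g j) ∧ g n <+: w := by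
  induction n generalizing w with
  | zero =>
    refine ⟨fun _ => [], fun i hi => ?_, fun _ _ _ _ => List.prefix_rfl, List.nil_prefix⟩
    rw [height_nil]
    omega
  | succ n ih =>
    obtain ⟨x, hx, hxn⟩ := exists_prefix_height_eq w h
    obtain ⟨g, hg, hmono, hgx⟩ := ih x (by rw [hxn]; push_cast; omega)
    refine ⟨fun i => if i ≤ n then g i else x, fun i hi => ?_, fun i j hij hj => ?_, ?_⟩
    · dsimp only
      split_ifs with hin
      · exact hg i hin
      · rw [hxn, show i = n + 1 by omega]
    · dsimp only
      split_ifs with hi hj' hj'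
      · exact hmono i j hij hj'
      · exact (hmono i n hi le_rfl).trans hgx
      · omega
      · exact List.prefix_rfl
    · simpa using hx

/-- A prefix that climbs to at least the number of classes of a right congruence contains an
increasing cycle, which can be repeated. -/
theorem exists_pump {S : Type*} [Fintype S] (f : List (Letter 1) → S)
    (hf : ∀ x y z, f x = f y → f (x ++ z) = f (y ++ z)) (u : List (Letter 1))
    (hu : NonnegFrom 0 u) (h : (Fintype.card S : ℤ) ≤ height u) :
    ∃ p : ℕ, 1 ≤ p ∧ p ≤ Fintype.card S ∧ ∀ a : ℕ, ∃ u', f u' = f u ∧ NonnegFrom 0 u' ∧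
      height u' = height u + a * p := by
  obtain ⟨g, hg, hmono, hgu⟩ := exists_prefix_chain u h
  obtain ⟨i, j, hlt, hij⟩ : ∃ i j : Fin (Fintype.card S + 1), i < j ∧ f (g i) = f (g j) := by
    obtain ⟨i, j, hne, heq⟩ := Fintype.exists_ne_map_eq_of_card_lt
      (fun i : Fin (Fintype.card S + 1) => f (g i)) (by simp)
    rcases lt_or_gt_of_ne hne with h | h
    · exact ⟨i, j, h, heq⟩
    · exact ⟨j, i, h, heq.symm⟩
  have hlt' : (i : ℕ) < j := hlt
  have hj := j.2
  obtain ⟨c, hc⟩ := hmono i j hlt'.le (by omega)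
  obtain ⟨z, rfl⟩ := (hmono j _ (by omega) le_rfl).trans hgu
  have hcj : height c = (j : ℤ) - i := by
    have := hg j (by omega)
    rw [← hc, height_append, hg i (by omega)] at this
    omega
  refine ⟨j - i, by omega, by omega, fun a => ?_⟩
  rw [nonnegFrom_append] at hu
  obtain ⟨hgj, hz⟩ := hu
  -- The cycle `c` is safe from height `i`, hence from every greater height, so each further copy is
  -- safe too.
  have hcn : NonnegFrom (i : ℤ) c := by
    rw [← hc, nonnegFrom_append, hg i (by omega)] at hgj
    simpa using hgj.2
  obtain ⟨y, hy, hyn, hyh⟩ : ∃ y, f y = f (g j) ∧ NonnegFrom 0 y ∧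
      height y = height (g j) + a * ((j - i : ℕ) : ℤ) := by
    induction a with
    | zero => exact ⟨g j, rfl, hgj, by simp⟩
    | succ a ih =>
      obtain ⟨y, hy, hyn, hyh⟩ := ih
      rw [hg j (by omega)] at hyh
      refine ⟨y ++ c, ?_, nonnegFrom_append.2 ⟨hyn, hcn.mono ?_⟩, ?_⟩
      · rw [hf y (g i) c (hy.trans hij.symm), hc]
      · rw [hyh]
        have : (0 : ℤ) ≤ a * ((j - i : ℕ) : ℤ) := by positivity
        omega
      · rw [height_append, hyh, hg j (by omega), hcj]
        push_cast [hlt'.le]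
        ring
  refine ⟨y ++ z, hf _ _ _ hy, nonnegFrom_append.2 ⟨hyn, hz.mono ?_⟩, ?_⟩
  · rw [hyh]
    have : (0 : ℤ) ≤ a * ((j - i : ℕ) : ℤ) := by positivity
    omega
  · rw [height_append, height_append, hyh]
    ring

/-- A word of an automaton that climbs, then does anything, then descends, and whose effect is
divisible by all cycle lengths, can be pumped to a Dyck word. -/
theorem exists_mem_dyck_of_climb {σ : Type} [Fintype σ] [DecidableEq σ] (M : DFA (Letter 1) σ)
    {u v y : List (Letter 1)} (hu : NonnegFrom 0 u) (hy : NonnegFrom 0 (mirror y))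
    (hcu : (Fintype.card (σ → σ) : ℤ) ≤ height u)
    (hcy : (Fintype.card (σ → σ) : ℤ) ≤ height (mirror y))
    (hdvd : ((Fintype.card (σ → σ)).factorial : ℤ) ∣ height (u ++ v ++ y))
    (hacc : u ++ v ++ y ∈ M.accepts) : ∃ w ∈ M.accepts, w ∈ dyck 1 := by
  set N := Fintype.card (σ → σ)
  -- Transition functions give a two-sided congruence, so the same classes serve the prefix and the
  -- mirrored suffix.
  let f : List (Letter 1) → σ → σ := fun w s => M.evalFrom s w
  have hfapp : ∀ x z, f (x ++ z) = f z ∘ f x := fun x z => by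
    funext s
    exact M.evalFrom_of_append s x z
  obtain ⟨p, hp1, hpN, hp⟩ := exists_pump f (fun x y z h => by rw [hfapp, hfapp, h]) u hu hcu
  obtain ⟨q, hq1, hqN, hq⟩ := exists_pump (fun w => f (mirror w))
    (fun x y z h => by
      change f (mirror x) = f (mirror y) at h
      rw [mirror_append, mirror_append, hfapp, hfapp, h]) (mirror y) hy hcy
  obtain ⟨p', hp'⟩ := Nat.dvd_factorial hp1 hpN
  obtain ⟨q', hq'⟩ := Nat.dvd_factorial hq1 hqN
  obtain ⟨c, hc⟩ := hdvd
  set m := N.factorial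
  have hm : 1 ≤ m := N.factorial_pos
  -- The total effect is `m * c`. Raising `u` by `m * A` and deepening the descent by `m * (A + c)`
  -- cancels it; `A` makes both amounts nonnegative and lifts `v` clear of 0.
  let A : ℕ := v.length + c.natAbs
  obtain ⟨u', hfu, hnu, hhu⟩ := hp (p' * A)
  obtain ⟨y', hfy, hny, hhy⟩ := hq (q' * (A + c).toNat)
  have hA : 0 ≤ (A : ℤ) + c := by omega
  have hhu' : height u' = height u + m * A := by
    rw [hhu, hp']
    push_cast
    ring
  have hhy' : height y' = -height y + m * (A + c) := by
    rw [hhy, hq', height_mirror]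
    push_cast [Int.toNat_of_nonneg hA]
    ring
  refine ⟨u' ++ v ++ mirror y', ?_, append_mem_dyck (nonnegFrom_append.2 ⟨hnu, ?_⟩) ?_ ?_⟩
  · have h : f (u' ++ v ++ mirror y') = f (u ++ v ++ y) := by
      change f (mirror y') = f (mirror (mirror y)) at hfy
      rw [hfapp, hfapp, hfapp, hfapp, hfu, hfy, mirror_mirror]
    change M.evalFrom M.start _ ∈ M.accept
    have := congrFun h M.start
    change M.evalFrom M.start _ = M.evalFrom M.start _ at this
    rw [this]
    exact hacc
  · refine (nonnegFrom_length v).mono ?_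
    have h1 : (0 : ℤ) ≤ height u := le_trans (by positivity) hcu
    have h2 : (A : ℤ) ≤ m * A := le_mul_of_one_le_left (by positivity) (by exact_mod_cast hm)
    omega
  · rwa [mirror_mirror]
  · rw [height_append, height_mirror, hhu', hhy']
    rw [height_append, height_append] at hc
    linear_combination hc

/-! ### Covering by basic separators -/

/-- The counter first leaves `[0, k]` downwards, never, or upwards; unit steps make the upward exit
land exactly on `k + 1`. -/
theorem mem_covSep_or_bounded_or_climb (k : ℕ) (w : List (Letter 1)) :
    w ∈ covSep k 0 ∨ (∀ u, u <+: w → 0 ≤ height u ∧ height u ≤ k) ∨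
      ∃ u v, w = u ++ v ∧ height u = k + 1 ∧
        ∀ t, t <+: u → t ≠ u → 0 ≤ height t ∧ height t ≤ k := by
  induction w using List.reverseRecOn with
  | nil =>
    refine Or.inr (Or.inl fun u hu => ?_)
    rw [List.prefix_nil.1 hu, height_nil]
    omega
  | append_singleton w a ih =>
    rcases ih with ⟨u, v, rfl, h⟩ | h | ⟨u, v, rfl, h⟩
    · exact Or.inl ⟨u, v ++ [a], by simp, h⟩
    · have hproper : ∀ t, t <+: w ++ [a] → t ≠ w ++ [a] → 0 ≤ height t ∧ height t ≤ k :=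
        fun t ht hne => h t ((List.prefix_concat_iff.1 ht).resolve_left hne)
      by_cases h0 : height (w ++ [a]) < 0
      · exact Or.inl ⟨w ++ [a], [], by simp, h0, hproper⟩
      by_cases hk : height (w ++ [a]) ≤ k
      · refine Or.inr (Or.inl fun t ht => ?_)
        by_cases hne : t = w ++ [a]
        · subst hne
          exact ⟨by omega, hk⟩
        · exact hproper t ht hne
      · refine Or.inr (Or.inr ⟨w ++ [a], [], by simp, ?_, hproper⟩)
        have hw := h w List.prefix_rfl
        rw [height_append] at hk ⊢
        rcases height_singleton a with h' | h' <;> omega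
    · exact Or.inr (Or.inr ⟨u, v ++ [a], by simp, h⟩)

theorem mem_revCovSep_of_mirror_mem_covSep {k : ℕ} {w : List (Letter 1)}
    (h : mirror w ∈ covSep k 0) : w ∈ revCovSep k 0 := by
  obtain ⟨u, v, huv, hneg, hu⟩ := h
  refine ⟨mirror v, mirror u, ?_, ?_, fun s hs hne => ?_⟩
  · rw [← mirror_append, ← huv, mirror_mirror]
  · change -height (mirror u) < 0
    rw [height_mirror, neg_neg]
    exact hneg
  · have h1 := hu (mirror s) (by simpa [mirror_mirror] using mirror_prefix_mirror hs)
      (fun he => hne (by rw [← he, mirror_mirror]))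
    change 0 ≤ height (mirror s) ∧ height (mirror s) ≤ k at h1
    rw [height_mirror] at h1
    exact h1

theorem nonnegFrom_of_climb {k : ℕ} {u : List (Letter 1)} (hk : height u = k + 1)
    (h : ∀ t, t <+: u → t ≠ u → 0 ≤ height t ∧ height t ≤ k) : NonnegFrom 0 u := fun t ht => by
  by_cases hne : t = u
  · subst hne
    omega
  · have := h t ht hne
    omega

/-- A word outside the Dyck language that lies in none of the two coverability separators climbs,
then does anything, then descends. -/
theorem exists_climb_of_notMem {k : ℕ} {w : List (Letter 1)} (hw : w ∉ dyck 1)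
    (h₁ : w ∉ covSep k 0) (h₂ : w ∉ revCovSep k 0) :
    ∃ u v y, w = u ++ v ++ y ∧ NonnegFrom 0 u ∧ NonnegFrom 0 (mirror y) ∧
      height u = k + 1 ∧ height (mirror y) = k + 1 := by
  have h₂' : mirror w ∉ covSep k 0 := fun h => h₂ (mem_revCovSep_of_mirror_mem_covSep h)
  rcases (mem_covSep_or_bounded_or_climb k w).resolve_left h₁ with hb | ⟨u, v, rfl, hk, hu⟩
  · have hne : height w ≠ 0 := fun h0 =>
      hw (mem_dyck_one_iff.2 ⟨fun u hu => by simpa using (hb u hu).1, h0⟩)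
    have hw0 := hb w List.prefix_rfl
    rcases (mem_covSep_or_bounded_or_climb k (mirror w)).resolve_left h₂' with
      hb' | ⟨y, v, hyv, hky, hy⟩
    · have := hb' (mirror w) List.prefix_rfl
      rw [height_mirror] at this
      omega
    · have h3 : w = mirror v ++ mirror y := by rw [← mirror_append, ← hyv, mirror_mirror]
      have h4 := hb (mirror v) (h3 ▸ List.prefix_append _ _)
      rw [h3, height_append, height_mirror y] at hw0
      omega
  · rcases (mem_covSep_or_bounded_or_climb k (mirror (u ++ v))).resolve_left h₂' with
      hb' | ⟨y, z, hyz, hky, hy⟩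
    · have h3 := hb' (mirror v) (by rw [mirror_append]; exact List.prefix_append _ _)
      have h4 := hb' _ List.prefix_rfl
      rw [height_mirror] at h3 h4
      rw [height_append] at h4
      omega
    · have h3 : u ++ v = mirror z ++ mirror y := by rw [← mirror_append, ← hyz, mirror_mirror]
      have hnu := nonnegFrom_of_climb hk hu
      have hny := nonnegFrom_of_climb hky hy
      rcases List.append_eq_append_iff.1 h3 with ⟨c, hc, hv⟩ | ⟨c, hc, hv⟩
      · exact ⟨u, c, mirror y, by rw [hv, List.append_assoc], hnu, by rwa [mirror_mirror], hk,
          by rwa [mirror_mirror]⟩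
      · rcases eq_or_ne c [] with rfl | hne
        · refine ⟨u, [], mirror y, ?_, hnu, by rwa [mirror_mirror], hk, by rwa [mirror_mirror]⟩
          rw [List.nil_append] at hv
          rw [List.append_nil, hv]
        -- The climb and the descent would overlap in `c`. Then the effect of the whole word is at
        -- least 1, computed as `u` followed by `v`, and at most -1, computed as `mirror z` followed
        -- by `mirror y`.
        · exfalso
          have h4 := hu (mirror z) (hc ▸ List.prefix_append _ _) fun h => hne (by
            rw [hc] at h
            simpa using h)
          have hy' : y = mirror v ++ mirror c := by
            rw [← mirror_append, ← hv, mirror_mirror]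
          have h5 := hy (mirror v) (hy' ▸ List.prefix_append _ _) fun h => hne (by
            rw [hy'] at h
            have : mirror c = [] := by simpa using h
            simpa [mirror] using this)
          have h6 := congrArg height h3
          rw [height_append, height_append, height_mirror y] at h6
          rw [height_mirror v] at h5
          omega

theorem exists_basicSeparator_mem {L : Language (Letter 1)} (hL : L.IsRegular)
    (hdisj : ∀ w ∈ L, w ∉ dyck 1) :
    ∃ k m : ℕ, 1 ≤ m ∧ ∀ w ∈ L, w ∈ covSep k 0 ∨ w ∈ revCovSep k 0 ∨ ¬ (m : ℤ) ∣ height w := by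
  classical
  obtain ⟨σ, _, M, rfl⟩ := hL
  refine ⟨Fintype.card (σ → σ), (Fintype.card (σ → σ)).factorial, Nat.factorial_pos _,
    fun w hw => ?_⟩
  by_contra! hcon
  obtain ⟨h₁, h₂, hdvd⟩ := hcon
  obtain ⟨u, v, y, rfl, hu, hy, hku, hky⟩ := exists_climb_of_notMem (hdisj w hw) h₁ h₂
  obtain ⟨x, hx, hxd⟩ := exists_mem_dyck_of_climb M hu hy (by omega) (by omega) hdvd hw
  exact hdisj x hx hxd

/-! ### Presentations of linear sets -/

/-- Every linear set has a presentation in `X`. -/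
def PresentsAll {n : ℕ} (X : Set (LinearSet n)) : Prop :=
  ∀ L : LinearSet n, ∃ L' ∈ X, L'.carrier = L.carrier

theorem presentsAll_univ {n : ℕ} : PresentsAll (Set.univ : Set (LinearSet n)) :=
  fun L => ⟨L, trivial, rfl⟩

theorem presentsAll_minimalPresentations {n : ℕ}
    {r : Finset (Fin n → ℤ) → Finset (Fin n → ℤ) → Prop} (hr : WellFounded r) :
    PresentsAll (minimalPresentations r) := fun L => by
  obtain ⟨L', hL', hmin⟩ := (InvImage.wf LinearSet.periods hr).has_min
    {L' | L'.carrier = L.carrier} ⟨L, rfl⟩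
  have hL' : L'.carrier = L.carrier := hL'
  exact ⟨L', fun L'' h => hmin L'' (h.trans hL'), hL'⟩

theorem carrier_mk_empty {n : ℕ} (b : Fin n → ℤ) : (LinearSet.mk b ∅).carrier = {b} := by
  ext x
  simp [LinearSet.carrier]

theorem carrier_mk_pair (b : Fin 1 → ℤ) (m : ℤ) :
    (LinearSet.mk b {fun _ => m, fun _ => -m}).carrier = {x | m ∣ x 0 - b 0} := by
  ext x
  simp only [LinearSet.carrier, Set.mem_ofPred_eq, Finset.coe_insert, Finset.coe_singleton]
  constructor
  · rintro ⟨y, hy, rfl⟩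
    have : m ∣ y 0 := by
      induction hy using AddSubmonoid.closure_induction with
      | mem z hz =>
        rcases hz with rfl | rfl
        · exact dvd_rfl
        · exact (dvd_neg).2 dvd_rfl
      | zero => exact dvd_zero _
      | add z z' _ _ h h' => exact dvd_add h h'
    simpa using this
  · rintro ⟨c, hc⟩
    refine ⟨x - b, ?_, by abel⟩
    rcases Int.eq_nat_or_neg c with ⟨a, rfl | rfl⟩
    · have : x - b = a • (fun _ => m) := by
        funext i
        rw [Subsingleton.elim i 0, Pi.sub_apply, hc, Pi.smul_apply, nsmul_eq_mul, mul_comm]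
      rw [this]
      exact nsmul_mem (AddSubmonoid.subset_closure (by simp)) a
    · have : x - b = a • (fun _ => -m) := by
        funext i
        rw [Subsingleton.elim i 0, Pi.sub_apply, hc, Pi.smul_apply, nsmul_eq_mul]
        ring
      rw [this]
      exact nsmul_mem (AddSubmonoid.subset_closure (by simp)) a

/-- Were all periods nonpositive, the base would be the maximum. This extracts a usable period from
an arbitrary presentation. -/
theorem exists_period_pos {L : LinearSet 1} (h : ∃ x ∈ L.carrier, L.base 0 < x 0) :
    ∃ p ∈ L.periods, 0 < p 0 := by
  by_contra! hcon
  obtain ⟨_, ⟨y, hy, rfl⟩, hlt⟩ := h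
  rw [Pi.add_apply] at hlt
  have : y 0 ≤ 0 := by
    clear hlt
    induction hy using AddSubmonoid.closure_induction with
    | mem z hz => exact hcon z hz
    | zero => exact le_rfl
    | add z z' _ _ h h' => exact add_nonpos h h'
  omega

theorem exists_period_neg {L : LinearSet 1} (h : ∃ x ∈ L.carrier, x 0 < L.base 0) :
    ∃ p ∈ L.periods, p 0 < 0 := by
  by_contra! hcon
  obtain ⟨_, ⟨y, hy, rfl⟩, hlt⟩ := h
  rw [Pi.add_apply] at hlt
  have : 0 ≤ y 0 := by
    clear hlt
    induction hy using AddSubmonoid.closure_induction with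
    | mem z hz => exact hcon z hz
    | zero => exact le_rfl
    | add z z' _ _ h h' => exact add_nonneg h h'
  omega

theorem base_mem_carrier {n : ℕ} (L : LinearSet n) : L.base ∈ L.carrier :=
  ⟨0, zero_mem _, by simp⟩

theorem base_add_mem_carrier {n : ℕ} {L : LinearSet n} {p : Fin n → ℤ} (hp : p ∈ L.periods) :
    L.base + p ∈ L.carrier :=
  ⟨p, AddSubmonoid.subset_closure hp, rfl⟩

/-- If the linear set is a residue class, then its approximations eventually contain all words with
effect in this class. -/
theorem eventually_mem_approx_of_carrier_eq {L : LinearSet 1} {m v : ℤ} (hm : 1 ≤ m)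
    (hL : L.carrier = {x | m ∣ x 0 - v}) :
    ∃ k₀ : ℕ, ∀ k ≥ k₀, ∀ w, m ∣ height w - v → w ∈ approx k L := by
  have hb : m ∣ L.base 0 - v := by
    have := base_mem_carrier L
    rwa [hL] at this
  obtain ⟨p, hp, hp0⟩ : ∃ p ∈ L.periods, 0 < p 0 := exists_period_pos
    ⟨fun _ => L.base 0 + m, by
      rw [hL]
      change m ∣ L.base 0 + m - v
      rw [show L.base 0 + m - v = L.base 0 - v + m by ring]
      exact dvd_add hb dvd_rfl, by dsimp only; omega⟩
  obtain ⟨q, hq, hq0⟩ : ∃ q ∈ L.periods, q 0 < 0 := exists_period_neg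
    ⟨fun _ => L.base 0 - m, by
      rw [hL]
      change m ∣ L.base 0 - m - v
      rw [show L.base 0 - m - v = L.base 0 - v - m by ring]
      exact dvd_sub hb dvd_rfl, by dsimp only; omega⟩
  have hdvd : ∀ z ∈ L.periods, m ∣ z 0 := fun z hz => by
    have := base_add_mem_carrier hz
    rw [hL] at this
    change m ∣ L.base 0 + z 0 - v at this
    rw [show L.base 0 + z 0 - v = L.base 0 - v + z 0 by ring] at this
    exact (Int.dvd_add_right hb).1 this
  -- The run stays strictly inside the box, so the next letter can always be read; on reaching `k`
  -- it subtracts `p`, on reaching `-k` it subtracts `q`. Since both periods are nonzero, this bound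
  -- makes each correction land strictly inside again.
  refine ⟨(p 0).natAbs + (q 0).natAbs, fun k hk => ?_⟩
  have key : ∀ w : List (Letter 1), ∃ x : Box 1 k, x ∈ (approxNFA k L).eval w ∧
      -(k : ℤ) < x.1 0 ∧ x.1 0 < k ∧ m ∣ height w - x.1 0 := by
    intro w
    induction w using List.reverseRecOn with
    | nil =>
      exact ⟨⟨0, fun i => by simp⟩, εNFA.subset_εClosure _ _ rfl, by simp; omega, by simp; omega,
        by simp [height_nil]⟩
    | append_singleton w a ih =>
      obtain ⟨x, hx, hlo, hhi, hd⟩ := ih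
      have hla : letterEffect a 0 = height [a] := by simp [height, effect_singleton]
      have ha := height_singleton a
      let x₁ : Box 1 k := ⟨x.1 + letterEffect a, fun i => by
        rw [Subsingleton.elim i 0, Pi.add_apply]
        omega⟩
      have hx₁0 : x₁.1 0 = x.1 0 + height [a] := by
        rw [← hla]
        rfl
      have hx₁ : x₁ ∈ (approxNFA k L).eval (w ++ [a]) := by
        rw [εNFA.eval_append_singleton, εNFA.mem_stepSet_iff]
        exact ⟨x, hx, εNFA.subset_εClosure _ _ rfl⟩
      have hstep : ∀ z ∈ L.periods, ∀ x₂ : Box 1 k, x₂.1 = x₁.1 - z →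
          x₂ ∈ (approxNFA k L).eval (w ++ [a]) := fun z hz x₂ h => by
        rw [εNFA.eval_append_singleton, εNFA.mem_stepSet_iff]
        exact ⟨x, hx, εNFA.εClosure.step x₁ x₂ ⟨z, hz, h⟩ (εNFA.subset_εClosure _ _ rfl)⟩
      have hd₁ : m ∣ height (w ++ [a]) - x₁.1 0 := by
        rw [height_append, hx₁0]
        convert hd using 1
        ring
      by_cases h1 : x₁.1 0 = k
      · refine ⟨⟨x₁.1 - p, fun i => ?_⟩, hstep p hp _ rfl, ?_, ?_, ?_⟩
        · rw [Subsingleton.elim i 0, Pi.sub_apply]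
          omega
        · change -(k : ℤ) < x₁.1 0 - p 0
          omega
        · change x₁.1 0 - p 0 < k
          omega
        · change m ∣ height (w ++ [a]) - (x₁.1 0 - p 0)
          rw [← sub_add]
          exact dvd_add hd₁ (hdvd p hp)
      by_cases h2 : x₁.1 0 = -k
      · refine ⟨⟨x₁.1 - q, fun i => ?_⟩, hstep q hq _ rfl, ?_, ?_, ?_⟩
        · rw [Subsingleton.elim i 0, Pi.sub_apply]
          omega
        · change -(k : ℤ) < x₁.1 0 - q 0
          omega
        · change x₁.1 0 - q 0 < k
          omega
        · change m ∣ height (w ++ [a]) - (x₁.1 0 - q 0)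
          rw [← sub_add]
          exact dvd_add hd₁ (hdvd q hq)
      · have := x₁.2 0
        exact ⟨x₁, hx₁, by omega, by omega, hd₁⟩
  intro w hw
  obtain ⟨x, hx, -, -, hd⟩ := key w
  refine ⟨x, ?_, hx⟩
  change x.1 ∈ L.carrier
  rw [hL]
  change m ∣ x.1 0 - v
  rw [show x.1 0 - v = height w - v - (height w - x.1 0) by ring]
  exact dvd_sub hw hd

theorem mem_approx_of_carrier_eq_singleton {L : LinearSet 1} {k : ℕ} {b : ℤ}
    (hL : L.carrier = {fun _ => b}) {w : List (Letter 1)} (hw : height w = b)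
    (h : ∀ u, u <+: w → -(k : ℤ) ≤ height u ∧ height u ≤ k) : w ∈ approx k L := by
  refine mem_approx_of_bounded L w (fun u hu i => ?_) ?_
  · rw [Subsingleton.elim i 0]
    exact h u hu
  · rw [hL]
    refine funext fun i => ?_
    rw [Subsingleton.elim i 0]
    exact hw

/-! ### Covering the basic separators -/

theorem finitelyCovers_of_subset_mem {α : Type} {B : Set (Language α)} {L K : Language α}
    (hK : K ∈ B) (h : ∀ w ∈ L, w ∈ K) : FinitelyCovers B L :=
  ⟨{K}, by simpa using hK, Set.finite_singleton K, fun w hw => ⟨K, rfl, h w hw⟩⟩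

theorem finitelyCovers_of_iUnion {α ι : Type} [Finite ι] {B : Set (Language α)} {L : Language α}
    {K : ι → Language α} (hK : ∀ i, FinitelyCovers B (K i)) (h : ∀ w ∈ L, ∃ i, w ∈ K i) :
    FinitelyCovers B L := by
  choose C hCB hC hKC using hK
  refine ⟨⋃ i, C i, Set.iUnion_subset hCB, Set.finite_iUnion hC, fun w hw => ?_⟩
  obtain ⟨i, hi⟩ := h w hw
  obtain ⟨K', hK', hwK'⟩ := hKC i w hi
  exact ⟨K', Set.mem_iUnion.2 ⟨i, hK'⟩, hwK'⟩

variable {X : Set (LinearSet 1)}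

theorem PresentsAll.exists_singleton (hX : PresentsAll X) (b : ℤ) :
    ∃ L ∈ X, L.carrier = {fun _ => b} := by
  obtain ⟨L, hL, h⟩ := hX ⟨fun _ => b, ∅⟩
  exact ⟨L, hL, h.trans (carrier_mk_empty _)⟩

theorem PresentsAll.exists_residueClass (hX : PresentsAll X) (m v : ℤ) :
    ∃ L ∈ X, L.carrier = {x | m ∣ x 0 - v} := by
  obtain ⟨L, hL, h⟩ := hX ⟨fun _ => v, {fun _ => m, fun _ => -m}⟩
  exact ⟨L, hL, h.trans (carrier_mk_pair _ _)⟩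

theorem finitelyCovers_modLang (hX : PresentsAll X) {m : ℕ} {v : Fin 1 → ℤ} (hm : 1 ≤ m)
    (hv : ∃ i, ¬ v i ≡ 0 [ZMOD m]) : FinitelyCovers (approxConcat X 2) (modLang m v) := by
  obtain ⟨i, hv⟩ := hv
  rw [Subsingleton.elim i 0, Int.modEq_zero_iff_dvd] at hv
  obtain ⟨L₁, hL₁, h₁⟩ := hX.exists_residueClass m (v 0)
  obtain ⟨L₂, hL₂, h₂⟩ := hX.exists_singleton 0
  obtain ⟨k, hk⟩ := eventually_mem_approx_of_carrier_eq (by exact_mod_cast hm) h₁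
  refine finitelyCovers_of_subset_mem
    (mem_approxConcat_two.2 ⟨k, L₁, L₂, hL₁, hL₂, ?_, rfl⟩) fun w hw => ?_
  · rintro ⟨-, x, hx, -, y, hy, h⟩
    rw [h₁] at hx
    rw [h₂] at hy
    have hx : (m : ℤ) ∣ x 0 - v 0 := hx
    have hy : y = fun _ => 0 := hy
    have h0 : 0 = x 0 + y 0 := congrFun h 0
    rw [hy] at h0
    rw [show x 0 = 0 by simpa using h0.symm, zero_sub, dvd_neg] at hx
    exact hv hx
  -- The second factor contributes only the empty word.
  · refine ⟨w, hk k le_rfl w ((hw 0).symm.dvd), [], ?_, by simp⟩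
    refine mem_approx_of_carrier_eq_singleton h₂ height_nil fun u hu => ?_
    rw [List.prefix_nil.1 hu, height_nil]
    omega

theorem height_bounds_of_covSep {k : ℕ} {w : List (Letter 1)} (hneg : height w < 0)
    (h : ∀ u, u <+: w → u ≠ w → 0 ≤ height u ∧ height u ≤ k) :
    height w = -1 ∧ ∀ u, u <+: w → -1 ≤ height u ∧ height u ≤ k := by
  have hw : height w = -1 := by
    rcases List.eq_nil_or_concat w with rfl | ⟨u, a, rfl⟩
    · rw [height_nil] at hneg
      omega
    · rw [List.concat_eq_append] at *
      have := h u (List.prefix_append _ _) (by simp)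
      rw [height_append] at hneg ⊢
      rcases height_singleton a with h' | h' <;> omega
  refine ⟨hw, fun u hu => ?_⟩
  by_cases hne : u = w
  · subst hne
    omega
  · have := h u hu hne
    omega

/-- `{-1}` has no nonnegative element, so the `⊙`-product is empty whatever the second set is; `ℤ`
absorbs the arbitrary rest `y`. -/
theorem finitelyCovers_covSep (hX : PresentsAll X) (k : ℕ) :
    FinitelyCovers (approxConcat X 2) (covSep k 0) := by
  obtain ⟨L₁, hL₁, h₁⟩ := hX.exists_singleton (-1)
  obtain ⟨L₂, hL₂, h₂⟩ := hX.exists_residueClass 1 0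
  obtain ⟨k₀, hk₀⟩ := eventually_mem_approx_of_carrier_eq le_rfl h₂
  refine finitelyCovers_of_subset_mem
    (mem_approxConcat_two.2 ⟨max k₀ (k + 1), L₁, L₂, hL₁, hL₂, ?_, rfl⟩) ?_
  · rintro ⟨-, x, hx, hx0, -⟩
    rw [h₁] at hx
    have hx : x = fun _ => -1 := hx
    have : 0 ≤ x 0 := hx0 0
    simp [hx] at this
  · rintro _ ⟨w, y, rfl, hneg, hw⟩
    obtain ⟨hw1, hb⟩ := height_bounds_of_covSep hneg hw
    refine ⟨w, mem_approx_of_carrier_eq_singleton h₁ hw1 fun u hu => ?_, y,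
      hk₀ _ (le_max_left _ _) y (one_dvd _), rfl⟩
    have := hb u hu
    omega

theorem finitelyCovers_revCovSep (hX : PresentsAll X) (k : ℕ) :
    FinitelyCovers (approxConcat X 2) (revCovSep k 0) := by
  obtain ⟨L₁, hL₁, h₁⟩ := hX.exists_residueClass 1 0
  obtain ⟨L₂, hL₂, h₂⟩ := hX.exists_singleton 1
  obtain ⟨k₀, hk₀⟩ := eventually_mem_approx_of_carrier_eq le_rfl h₁
  refine finitelyCovers_of_subset_mem
    (mem_approxConcat_two.2 ⟨max k₀ (k + 1), L₁, L₂, hL₁, hL₂, ?_, rfl⟩) ?_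
  · rintro ⟨-, x, -, hx0, y, hy, h⟩
    rw [h₂] at hy
    have hy : y = fun _ => 1 := hy
    have h0 : 0 = x 0 + y 0 := congrFun h 0
    have : 0 ≤ x 0 := hx0 0
    simp only [hy] at h0
    omega
  · rintro _ ⟨y, w, rfl, hneg, hw⟩
    change -height w < 0 at hneg
    obtain ⟨hw1, hb⟩ := height_bounds_of_covSep (w := mirror w) (k := k)
      (by rwa [height_mirror]) fun u hu hne => by
        have hs : mirror u <:+ w := by simpa [mirror_mirror] using mirror_suffix_mirror hu
        have := hw (mirror u) hs fun he => hne (by rw [← he, mirror_mirror])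
        change 0 ≤ -height (mirror u) ∧ -height (mirror u) ≤ k at this
        rwa [height_mirror, neg_neg] at this
    rw [height_mirror] at hw1
    refine ⟨y, hk₀ _ (le_max_left _ _) y (one_dvd _), w,
      mem_approx_of_carrier_eq_singleton h₂ (by omega) ?_, rfl⟩
    -- The effect of `u` is `1 + height (mirror t)`, which lies in `[0, k + 1]`; hence the bound `k
    -- + 1`.
    rintro u ⟨t, rfl⟩
    have := hb (mirror t) (by rw [mirror_append]; exact List.prefix_append _ _)
    rw [height_mirror] at this
    rw [height_append] at hw1
    omega

theorem finitelyCovers_oneCounterSeps (hX : PresentsAll X) :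
    ∀ K ∈ oneCounterSeps, FinitelyCovers (approxConcat X 2) K := by
  rintro K ((⟨m, v, hm, hv, rfl⟩ | ⟨k, rfl⟩) | ⟨k, rfl⟩)
  · exact finitelyCovers_modLang hX hm hv
  · exact finitelyCovers_covSep hX k
  · exact finitelyCovers_revCovSep hX k

theorem isBasicSeparatorSet_approxConcat_two (hX : PresentsAll X) :
    IsBasicSeparatorSet (dyck 1) (approxConcat X 2) := by
  refine ⟨fun K hK => ?_, fun K hK => ?_, fun L hL hdisj => ?_⟩
  · obtain ⟨k, L₁, L₂, -, -, -, rfl⟩ := mem_approxConcat_two.1 hK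
    exact isRegular_mul (approx_isRegular k L₁) (approx_isRegular k L₂)
  · obtain ⟨k, L₁, L₂, -, -, h0, rfl⟩ := mem_approxConcat_two.1 hK
    exact mul_disjoint_dyck h0
  · obtain ⟨k, m, hm, h⟩ := exists_basicSeparator_mem hL hdisj
    let K : Bool ⊕ {v : Fin m // (v : ℕ) ≠ 0} → Language (Letter 1)
      | .inl true => covSep k 0
      | .inl false => revCovSep k 0
      | .inr v => modLang m fun _ => (v.1 : ℕ)
    refine finitelyCovers_of_iUnion (K := K) ?_ fun w hw => ?_
    · rintro ((_ | _) | ⟨v, hv⟩)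
      · exact finitelyCovers_revCovSep hX k
      · exact finitelyCovers_covSep hX k
      · refine finitelyCovers_modLang hX hm ⟨0, ?_⟩
        rw [Int.modEq_zero_iff_dvd, Int.natCast_dvd_natCast]
        exact Nat.not_dvd_of_pos_of_lt (Nat.pos_of_ne_zero hv) v.2
    · rcases h w hw with h | h | h
      · exact ⟨.inl true, h⟩
      · exact ⟨.inl false, h⟩
      · have hm0 : (0 : ℤ) < m := by exact_mod_cast hm
        have hnn := Int.emod_nonneg (height w) hm0.ne'
        have hlt := Int.emod_lt_of_pos (height w) hm0
        refine ⟨.inr ⟨⟨(height w % m).toNat, by omega⟩, fun h0 => h ?_⟩, fun i => ?_⟩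
        · change (height w % m).toNat = 0 at h0
          exact Int.dvd_of_emod_eq_zero (by omega)
        · rw [Subsingleton.elim i 0]
          change height w ≡ ((height w % m).toNat : ℤ) [ZMOD m]
          rw [Int.toNat_of_nonneg hnn]
          exact (Int.mod_modEq _ _).symm

end DyckSep

theorem mainTheorem9 :
    (DyckSep.IsBasicSeparatorSet (DyckSep.dyck 1) (DyckSep.approxConcat Set.univ 2) ∧
      ∀ K ∈ DyckSep.oneCounterSeps,
        DyckSep.FinitelyCovers (DyckSep.approxConcat Set.univ 2) K) ∧
    ∀ r : Finset (Fin 1 → ℤ) → Finset (Fin 1 → ℤ) → Prop, IsWellOrder _ r →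
      DyckSep.IsBasicSeparatorSet (DyckSep.dyck 1)
          (DyckSep.approxConcat (DyckSep.minimalPresentations r) 2) ∧
        ∀ K ∈ DyckSep.oneCounterSeps,
          DyckSep.FinitelyCovers
            (DyckSep.approxConcat (DyckSep.minimalPresentations r) 2) K := by
  have h {X : Set (DyckSep.LinearSet 1)} (hX : DyckSep.PresentsAll X) :
      DyckSep.IsBasicSeparatorSet (DyckSep.dyck 1) (DyckSep.approxConcat X 2) ∧
        ∀ K ∈ DyckSep.oneCounterSeps, DyckSep.FinitelyCovers (DyckSep.approxConcat X 2) K :=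
    ⟨DyckSep.isBasicSeparatorSet_approxConcat_two hX, DyckSep.finitelyCovers_oneCounterSeps hX⟩
  exact ⟨h DyckSep.presentsAll_univ,
    fun r hr => h (DyckSep.presentsAll_minimalPresentations hr.toIsWellFounded.wf)⟩
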